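/- All manifolds are smooth, real, finite-dimensional and without boundary. Let $p:P\to M$ be a principal bundle with structure group a Lie group $G$ with Lie algebra $\mathfrak g=T_1G$: $G$ acts smoothly and freely on $P$ from the right by $r^g(u)=u.g$, the fibres of $p$ are the orbits, and $p$ is locally trivial through smooth $G$-equivariant trivializations. Let $V_uP=\ker T_up$, let $\zeta_u:\mathfrak g\to V_uP$, $\zeta_u(X)=\zeta_X(u)=\frac{d}{dt}|_{0}\,u.\exp(tX)$, and let $\kappa^v_u=\zeta_u^{-1}:V_uP\to\mathfrak g$. Let $\gamma\in\Omega^1(P;\mathfrak g)$ be a principal connection, i.e. $(r^g)^*\gamma=\mathrm{Ad}(g^{-1})\gamma$ for all $g\in G$ and $\gamma|_{VP}=\kappa^v$, and write $\zeta_\gamma:TP\to VP$, $\zeta_\gamma(\xi_u)=\zeta_{\gamma(\xi_u)}(u)$. Let $\pi:T^*P\to P$ be the cotangent bundle. For a diffeomorphism $\varphi$ of $P$ let $T^*\varphi:T^*P\to T^*P$ be the lift $T^*_uP\ni\alpha\mapsto\alpha\circ(T_u\varphi)^{-1}\in T^*_{\varphi(u)}P$; define $T^*r^g:V^*P\to V^*P$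 in the same way. For a smooth map $f:T^*P\to\mathfrak g^*$ put $$\Theta_{f,\gamma}=\langle f,\pi^*\gamma\rangle\in\Omega^1(T^*P),\qquad (\kappa^v)^*_f:T^*P\to V^*P,\quad (\kappa^v)^*_f|_{T^*_uP}=(\kappa^v_u)^*\circ f|_{T^*_uP},$$ and use the same formula for $\Theta_{f,\gamma'}$ with any $\gamma'\in\Omega^1(P;\mathfrak g)$. A gauge transformation is a diffeomorphism $\varphi:P\to P$ with $p\circ\varphi=p$ which commutes with the action of $G$; let $f_\varphi:P\to G$ be determined by $\varphi(u)=u.f_\varphi(u)$, and let $\kappa^l$ be the left Maurer–Cartan form of $G$. Then: (a) For every gauge transformation $\varphi$, the map $f_\varphi$ is smooth and satisfies $f_\varphi(u.g)=g^{-1}f_\varphi(u)g$; the form $\varphi^*\gamma=\gamma\circ T\varphi$ is again a principal connection, the map $f\circ T^*\varphi$ is again smooth, and $$\varphi^*\gamma=\mathrm{Ad}(f_\varphi^{-1})\gamma+f_\varphi^*\kappa^l,$$ $$(T^*\varphi)^*\Theta_{f,\gamma}=\langle f\circ T^*\varphi,\ \pi^*(\mathrm{Ad}(f_\varphi^{-1})\gamma+f_\varphi^*\kappa^l)\rangle=\Theta_{f\circ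 T^*\varphi,\,\varphi^*\gamma}.$$ (b) $\Theta_{f,\gamma}=\langle(\kappa^v)^*_f,\ \zeta_\gamma\circ T\pi\rangle_{VP}$. (c) $\Theta_{f,\gamma}$ is $G$-invariant, i.e. $(T^*r^g)^*\Theta_{f,\gamma}=\Theta_{f,\gamma}$ for all $g\in G$, if and only if $f\circ T^*r^g=\mathrm{Ad}(g)^*\circ f$ for all $g\in G$ (where $\mathrm{Ad}(g)^*$ is the transpose of $\mathrm{Ad}(g)$), and this holds if and only if $(\kappa^v)^*_f$ is $G$-equivariant, i.e. $(\kappa^v)^*_f\circ T^*r^g=T^*r^g\circ(\kappa^v)^*_f$ for all $g\in G$. -/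

import Mathlib

open scoped Manifold ContDiff RightActions
open Bundle

/-! Manifolds are smooth real manifolds without boundary; `N` is modelled on the normed space `E`
through the model with corners `𝓘(ℝ, E)`. In Mathlib every tangent space of `N` is a copy of `E`
(the tangent space read in the preferred chart at the point), so the tangent spaces at two points
that are provably equal (such as `g * 1 * g⁻¹` and `1`) are the same type, with the correct
identification. This is used in the definitions of `adjointAction`, `leftMaurerCartan` and
`fundamentalMap` below. -/

noncomputable section

/-! ### One-forms, the cotangent bundle and the lift of diffeomorphisms -/

section Cotangent

/-- The cotangent space `T*_u N`. -/
abbrev CotangentSpace (E : Type*) {N : Type*} [NormedAddCommGroup E] [NormedSpace ℝ E]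
    [TopologicalSpace N] [ChartedSpace E N] (u : N) : Type _ :=
  TangentSpace 𝓘(ℝ, E) u →L[ℝ] Bundle.Trivial N ℝ u

/-- The cotangent bundle `T*N`, with Mathlib's manifold structure on the bundle of
continuous linear maps from the tangent bundle to the trivial line bundle. -/
abbrev CotangentBundle (E N : Type*) [NormedAddCommGroup E] [NormedSpace ℝ E]
    [TopologicalSpace N] [ChartedSpace E N] : Type _ :=
  TotalSpace (E →L[ℝ] ℝ) (fun u : N => CotangentSpace E u)

/-- The model with corners of `T*N`. -/
abbrev cotangentModel (E : Type*) [NormedAddCommGroup E] [NormedSpace ℝ E] :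
    ModelWithCorners ℝ (E × (E →L[ℝ] ℝ)) (ModelProd E (E →L[ℝ] ℝ)) :=
  𝓘(ℝ, E).prod 𝓘(ℝ, E →L[ℝ] ℝ)

/-- The projection `π : T*N → N`. -/
def cotangentProj (E N : Type*) [NormedAddCommGroup E] [NormedSpace ℝ E]
    [TopologicalSpace N] [ChartedSpace E N] : CotangentBundle E N → N :=
  fun α => α.proj

variable {E N : Type*} [NormedAddCommGroup E] [NormedSpace ℝ E] [TopologicalSpace N]
  [ChartedSpace E N] [IsManifold 𝓘(ℝ, E) ∞ N]

/-- A real one-form on `N`, as a section of `T*N → N`, is smooth. -/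
def IsSmoothOneForm (α : ∀ u : N, CotangentSpace E u) : Prop :=
  ContMDiff 𝓘(ℝ, E) (cotangentModel E) ∞ (fun u => (⟨u, α u⟩ : CotangentBundle E N))

/-- The natural lift `T*φ : T*N → T*N` of a diffeomorphism `φ` of `N`: it covers `φ` and sends
`α ∈ T*_u N` to `α ∘ (T_u φ)⁻¹ ∈ T*_{φ(u)} N`. -/
def cotangentLift (φ : N ≃ₘ⟮𝓘(ℝ, E), 𝓘(ℝ, E)⟯ N) : CotangentBundle E N → CotangentBundle E N :=
  fun α => ⟨φ α.proj,
    α.snd ∘L ((φ.mfderivToContinuousLinearEquiv (by simp) α.proj).symm :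
      TangentSpace 𝓘(ℝ, E) (φ α.proj) →L[ℝ] TangentSpace 𝓘(ℝ, E) α.proj)⟩

/-- The pullback `(T*φ)^* Θ` of a one-form `Θ` on `T*N`. -/
def cotangentPullback (φ : N ≃ₘ⟮𝓘(ℝ, E), 𝓘(ℝ, E)⟯ N)
    (Θ : ∀ α : CotangentBundle E N, TangentSpace (cotangentModel E) α →L[ℝ] ℝ) :
    ∀ α : CotangentBundle E N, TangentSpace (cotangentModel E) α →L[ℝ] ℝ :=
  fun α => Θ (cotangentLift φ α) ∘L
    mfderiv (cotangentModel E) (cotangentModel E) (cotangentLift φ) α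

end Cotangent

/-! ### The structure group -/

section Group

variable (E : Type*) {G : Type*} [NormedAddCommGroup E] [NormedSpace ℝ E]
  [TopologicalSpace G] [ChartedSpace E G] [Group G]

/-- The adjoint action `Ad(g) : 𝔤 → 𝔤`, the derivative at `1` of `h ↦ g h g⁻¹`. -/
def adjointAction (g : G) : GroupLieAlgebra 𝓘(ℝ, E) G →L[ℝ] GroupLieAlgebra 𝓘(ℝ, E) G :=
  mfderiv 𝓘(ℝ, E) 𝓘(ℝ, E) (fun h : G => g * h * g⁻¹) 1

/-- The left Maurer-Cartan form `κˡ`: `κˡ_g : T_g G → 𝔤` is the derivative at `g` of the left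
translation `h ↦ g⁻¹ h`. -/
def leftMaurerCartan (g : G) : TangentSpace 𝓘(ℝ, E) g →L[ℝ] GroupLieAlgebra 𝓘(ℝ, E) G :=
  mfderiv 𝓘(ℝ, E) 𝓘(ℝ, E) (fun h : G => g⁻¹ * h) g

end Group

/-! ### Principal bundles

`EP`, `EM`, `EG` are the model spaces of the total space `P`, the base `M` and the structure
group `G`. The right action of `G` on `P` is written `u <• g`. -/

section Principal

variable (EP EM EG : Type*) {P M G : Type*}
  [NormedAddCommGroup EP] [NormedSpace ℝ EP] [TopologicalSpace P] [ChartedSpace EP P]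
  [NormedAddCommGroup EM] [NormedSpace ℝ EM] [TopologicalSpace M] [ChartedSpace EM M]
  [NormedAddCommGroup EG] [NormedSpace ℝ EG] [TopologicalSpace G] [ChartedSpace EG G]
  [Group G] [MulAction Gᵐᵒᵖ P]

/-- `p : P → M` is a smooth principal bundle with structure group `G`: the right action of `G`
on `P` is smooth and free, the fibres of `p` are its orbits, and `p` is locally trivial, through
smooth `G`-equivariant local trivializations. -/
structure IsPrincipalBundle (G : Type*) [TopologicalSpace G] [ChartedSpace EG G] [Group G]
    [MulAction Gᵐᵒᵖ P] (p : P → M) : Prop where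
  contMDiff_proj : ContMDiff 𝓘(ℝ, EP) 𝓘(ℝ, EM) ∞ p
  surjective_proj : Function.Surjective p
  contMDiff_action : ContMDiff (𝓘(ℝ, EP).prod 𝓘(ℝ, EG)) 𝓘(ℝ, EP) ∞ (fun x : P × G => x.1 <• x.2)
  free : ∀ (u : P) (g : G), u <• g = u → g = 1
  proj_eq_iff : ∀ u v : P, p u = p v ↔ ∃ g : G, v = u <• g
  locally_trivial : ∀ x : M, ∃ e : Trivialization G p, x ∈ e.baseSet ∧
    ContMDiffOn 𝓘(ℝ, EP) (𝓘(ℝ, EM).prod 𝓘(ℝ, EG)) ∞ e e.source ∧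
    ContMDiffOn (𝓘(ℝ, EM).prod 𝓘(ℝ, EG)) 𝓘(ℝ, EP) ∞ e.toOpenPartialHomeomorph.symm e.target ∧
    ∀ u ∈ e.source, ∀ g : G, (e (u <• g)).2 = (e u).2 * g

variable {EP EM EG}

namespace IsPrincipalBundle

variable {p : P → M} (h : IsPrincipalBundle EP EM EG G p)

theorem proj_smul (h : IsPrincipalBundle EP EM EG G p) (u : P) (g : G) : p (u <• g) = p u :=
  ((h.proj_eq_iff u _).2 ⟨g, rfl⟩).symm

/-- The right translation `r^g : P → P`, `u ↦ u g`, as a diffeomorphism. -/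
def rightTranslation (g : G) : P ≃ₘ⟮𝓘(ℝ, EP), 𝓘(ℝ, EP)⟯ P where
  toFun u := u <• g
  invFun u := u <• g⁻¹
  left_inv u := by simp
  right_inv u := by simp
  contMDiff_toFun := h.contMDiff_action.comp (contMDiff_id.prodMk contMDiff_const)
  contMDiff_invFun := h.contMDiff_action.comp (contMDiff_id.prodMk contMDiff_const)

/-- The vertical space `V_u P`, the kernel of `T_u p`. -/
def verticalSpace (_h : IsPrincipalBundle EP EM EG G p) (u : P) :
    Submodule ℝ (TangentSpace 𝓘(ℝ, EP) u) :=
  LinearMap.ker (mfderiv 𝓘(ℝ, EP) 𝓘(ℝ, EM) p u).toLinearMap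

/-- The map `𝔤 → T_u P`, `X ↦ ζ_X(u)`, where `ζ_X` is the fundamental vector field of `X`: the
derivative at `1` of the orbit map `g ↦ u g`. -/
def fundamentalMap (_h : IsPrincipalBundle EP EM EG G p) (u : P) :
    GroupLieAlgebra 𝓘(ℝ, EG) G →L[ℝ] TangentSpace 𝓘(ℝ, EP) u :=
  mfderiv 𝓘(ℝ, EG) 𝓘(ℝ, EP) (fun g : G => u <• g) 1

theorem contMDiff_orbit (h : IsPrincipalBundle EP EM EG G p) (u : P) : ContMDiff 𝓘(ℝ, EG) 𝓘(ℝ, EP) ∞ (fun g : G => u <• g) :=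
  h.contMDiff_action.comp (contMDiff_const.prodMk contMDiff_id)

theorem fundamentalMap_mem (u : P) (X : GroupLieAlgebra 𝓘(ℝ, EG) G) :
    h.fundamentalMap u X ∈ h.verticalSpace u := by
  have h1 : HasMFDerivAt 𝓘(ℝ, EG) 𝓘(ℝ, EP) (fun g : G => u <• g) 1 (h.fundamentalMap u) :=
    ((h.contMDiff_orbit u).mdifferentiable (by simp) 1).hasMFDerivAt
  have h2 : HasMFDerivAt 𝓘(ℝ, EP) 𝓘(ℝ, EM) p (u <• (1 : G))
      (mfderiv 𝓘(ℝ, EP) 𝓘(ℝ, EM) p (u <• (1 : G))) :=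
    (h.contMDiff_proj.mdifferentiable (by simp) _).hasMFDerivAt
  have h3 := h2.comp (1 : G) h1
  have h4 : (p ∘ fun g : G => u <• g) = fun _ => p u := by
    funext g; exact h.proj_smul u g
  rw [h4] at h3
  have h5 := hasMFDerivAt_unique h3 (hasMFDerivAt_const (p u) (1 : G))
  have h6 := DFunLike.congr_fun h5 X
  rw [MulOpposite.op_one, one_smul] at h6
  exact h6

/-- The map `ζ_u : 𝔤 → V_u P`, `X ↦ ζ_X(u)`. -/
def verticalFundamentalMap (u : P) : GroupLieAlgebra 𝓘(ℝ, EG) G →L[ℝ] h.verticalSpace u :=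
  (h.fundamentalMap u).codRestrict (h.verticalSpace u) (h.fundamentalMap_mem u)

/-- The vertical parallelism `κᵛ_u : V_u P → 𝔤`, the inverse of `ζ_u : 𝔤 → V_u P`. -/
def verticalParallelism (u : P) : h.verticalSpace u →L[ℝ] GroupLieAlgebra 𝓘(ℝ, EG) G :=
  (h.verticalFundamentalMap u).inverse

/-! ### The vertical cotangent bundle -/

/-- The dual `V*P` of the vertical bundle, as the set of pairs of a point `u` of `P` and a linear
form on `V_u P`. -/
abbrev VerticalCotangent : Type _ := Σ u : P, (h.verticalSpace u →L[ℝ] ℝ)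

theorem inverse_mfderiv_mem (h : IsPrincipalBundle EP EM EG G p)
    (φ : P ≃ₘ⟮𝓘(ℝ, EP), 𝓘(ℝ, EP)⟯ P) (hφ : ∀ u, p (φ u) = p u) (u : P)
    (w : TangentSpace 𝓘(ℝ, EP) (φ u)) (hw : w ∈ h.verticalSpace (φ u)) :
    (φ.mfderivToContinuousLinearEquiv (by simp) u).symm w ∈ h.verticalSpace u := by
  have h1 : HasMFDerivAt 𝓘(ℝ, EP) 𝓘(ℝ, EP) φ u (mfderiv 𝓘(ℝ, EP) 𝓘(ℝ, EP) φ u) :=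
    (φ.contMDiff.mdifferentiable (by simp) u).hasMFDerivAt
  have h2 : HasMFDerivAt 𝓘(ℝ, EP) 𝓘(ℝ, EM) p (φ u) (mfderiv 𝓘(ℝ, EP) 𝓘(ℝ, EM) p (φ u)) :=
    (h.contMDiff_proj.mdifferentiable (by simp) _).hasMFDerivAt
  have h3 := h2.comp u h1
  have h4 : p ∘ φ = p := funext hφ
  rw [h4] at h3
  have h5 := DFunLike.congr_fun h3.mfderiv
    ((φ.mfderivToContinuousLinearEquiv (by simp) u).symm w)
  have h6 : mfderiv 𝓘(ℝ, EP) 𝓘(ℝ, EP) φ u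
      ((φ.mfderivToContinuousLinearEquiv (by simp) u).symm w) = w :=
    (φ.mfderivToContinuousLinearEquiv (by simp) u).apply_symm_apply w
  have h7 : mfderiv 𝓘(ℝ, EP) 𝓘(ℝ, EM) p (φ u) w = 0 := hw
  refine h5.trans ?_
  refine (congrArg (mfderiv 𝓘(ℝ, EP) 𝓘(ℝ, EM) p (φ u)) h6).trans h7

/-- The restriction `(T_u φ)⁻¹ : V_{φ(u)} P → V_u P` for a diffeomorphism `φ` which respects the
fibres of `p`. -/
def verticalInverse (φ : P ≃ₘ⟮𝓘(ℝ, EP), 𝓘(ℝ, EP)⟯ P) (hφ : ∀ u, p (φ u) = p u) (u : P) :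
    h.verticalSpace (φ u) →L[ℝ] h.verticalSpace u :=
  (((φ.mfderivToContinuousLinearEquiv (by simp) u).symm :
      TangentSpace 𝓘(ℝ, EP) (φ u) →L[ℝ] TangentSpace 𝓘(ℝ, EP) u) ∘L
    (h.verticalSpace (φ u)).subtypeL).codRestrict (h.verticalSpace u)
    (fun w => h.inverse_mfderiv_mem φ hφ u w.1 w.2)

/-- The lift `T*r^g : V*P → V*P` of the right translation by `g`: it covers `r^g` and sends
`β ∈ V*_u P` to `β ∘ (T_u r^g)⁻¹ ∈ V*_{u g} P`. -/
def verticalCotangentLift (g : G) : h.VerticalCotangent → h.VerticalCotangent :=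
  fun β => ⟨h.rightTranslation g β.1,
    β.2 ∘L h.verticalInverse (h.rightTranslation g) (fun u => h.proj_smul u g) β.1⟩

/-! ### Gauge transformations and principal connections -/

/-- A gauge transformation of `P`: a diffeomorphism of `P` which respects the fibres of `p` and
commutes with the right action of `G`. -/
structure GaugeTransformation (_h : IsPrincipalBundle EP EM EG G p) where
  toDiffeomorph : P ≃ₘ⟮𝓘(ℝ, EP), 𝓘(ℝ, EP)⟯ P
  proj_apply : ∀ u, p (toDiffeomorph u) = p u
  map_smul : ∀ (u : P) (g : G), toDiffeomorph (u <• g) = toDiffeomorph u <• g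

theorem exists_gaugeFunction (h : IsPrincipalBundle EP EM EG G p) (φ : h.GaugeTransformation)
    (u : P) : ∃ g : G, φ.toDiffeomorph u = u <• g :=
  (h.proj_eq_iff u _).1 (φ.proj_apply u).symm

/-- The map `f_φ : P → G` of a gauge transformation `φ`; since the action is free, it is
determined by `φ(u) = u f_φ(u)`. -/
def gaugeFunction (φ : h.GaugeTransformation) (u : P) : G :=
  (h.exists_gaugeFunction φ u).choose

theorem gaugeFunction_spec (φ : h.GaugeTransformation) (u : P) :
    φ.toDiffeomorph u = u <• h.gaugeFunction φ u :=
  (h.exists_gaugeFunction φ u).choose_spec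

/-- The type of `𝔤`-valued one-forms on `P` (no smoothness is required here). -/
abbrev LieAlgebraForm (_h : IsPrincipalBundle EP EM EG G p) : Type _ :=
  ∀ u : P, TangentSpace 𝓘(ℝ, EP) u →L[ℝ] GroupLieAlgebra 𝓘(ℝ, EG) G

/-- `γ` is (the connection form of) a principal connection on `P`: a smooth `𝔤`-valued one-form
with `(r^g)^* γ = Ad(g⁻¹) γ` which restricts to the vertical parallelism on `VP`. As `𝔤` is
finite-dimensional, smoothness of `γ` is smoothness of its components. -/
structure IsPrincipalConnection [IsManifold 𝓘(ℝ, EP) ∞ P] (γ : h.LieAlgebraForm) : Prop where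
  smooth : ∀ ξ : GroupLieAlgebra 𝓘(ℝ, EG) G →L[ℝ] ℝ, IsSmoothOneForm (fun u => ξ ∘L γ u)
  equivariant : ∀ (g : G) (u : P),
    γ (h.rightTranslation g u) ∘L mfderiv 𝓘(ℝ, EP) 𝓘(ℝ, EP) (h.rightTranslation g) u =
      adjointAction EG g⁻¹ ∘L γ u
  vertical : ∀ u : P, γ u ∘L (h.verticalSpace u).subtypeL = h.verticalParallelism u

/-- The pullback `φ^* γ = γ ∘ Tφ` of a `𝔤`-valued one-form by a gauge transformation. -/
def gaugePullback (φ : h.GaugeTransformation) (γ : h.LieAlgebraForm) : h.LieAlgebraForm :=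
  fun u => γ (φ.toDiffeomorph u) ∘L mfderiv 𝓘(ℝ, EP) 𝓘(ℝ, EP) φ.toDiffeomorph u

/-- The `𝔤`-valued one-form `Ad(f_φ⁻¹) γ + f_φ^* κˡ`. -/
def gaugeTransform (φ : h.GaugeTransformation) (γ : h.LieAlgebraForm) : h.LieAlgebraForm :=
  fun u => adjointAction EG (h.gaugeFunction φ u)⁻¹ ∘L γ u +
    leftMaurerCartan EG (h.gaugeFunction φ u) ∘L
      mfderiv 𝓘(ℝ, EP) 𝓘(ℝ, EG) (h.gaugeFunction φ) u

/-- The projection `ζ_γ : TP → VP`, `ξ_u ↦ ζ_{γ(ξ_u)}(u)`. -/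
def verticalProjection (γ : h.LieAlgebraForm) (u : P) :
    TangentSpace 𝓘(ℝ, EP) u →L[ℝ] h.verticalSpace u :=
  h.verticalFundamentalMap u ∘L γ u

/-! ### Generalized momentum mappings and Liouville forms -/

/-- The type of maps `f : T*P → 𝔤*`. -/
abbrev MomentumMap (_h : IsPrincipalBundle EP EM EG G p) : Type _ :=
  CotangentBundle EP P → (GroupLieAlgebra 𝓘(ℝ, EG) G →L[ℝ] ℝ)

variable [IsManifold 𝓘(ℝ, EP) ∞ P]

/-- Smoothness of a map `f : T*P → 𝔤*` into the dual of the finite-dimensional space `𝔤`, as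
smoothness of the components `⟨f, X⟩` for `X ∈ 𝔤`. -/
def IsSmoothMomentum (f : h.MomentumMap) : Prop :=
  ∀ X : GroupLieAlgebra 𝓘(ℝ, EG) G,
    ContMDiff (cotangentModel EP) 𝓘(ℝ, ℝ) ∞ (fun α : CotangentBundle EP P => f α X)

/-- The generalized Liouville form `Θ_{f,γ} = ⟨f, π^* γ⟩` on `T*P`. -/
def liouvilleForm (f : h.MomentumMap) (γ : h.LieAlgebraForm) (α : CotangentBundle EP P) :
    TangentSpace (cotangentModel EP) α →L[ℝ] ℝ :=
  f α ∘L γ (cotangentProj EP P α) ∘L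
    mfderiv (cotangentModel EP) 𝓘(ℝ, EP) (cotangentProj EP P) α

/-- The map `(κᵛ)^*_f : T*P → V*P`, given on `T*_u P` by `(κᵛ_u)^* ∘ f`. -/
def verticalMomentum (f : h.MomentumMap) (α : CotangentBundle EP P) : h.VerticalCotangent :=
  ⟨cotangentProj EP P α, f α ∘L h.verticalParallelism (cotangentProj EP P α)⟩

/-- `Θ` is invariant under the action `g ↦ T*r^g` of `G` on `T*P`. -/
def IsInvariantForm
    (Θ : ∀ α : CotangentBundle EP P, TangentSpace (cotangentModel EP) α →L[ℝ] ℝ) : Prop :=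
  ∀ g : G, cotangentPullback (h.rightTranslation g) Θ = Θ

/-- `f ∘ T*r^g = Ad(g)^* ∘ f` for all `g`, where `Ad(g)^* : 𝔤* → 𝔤*` is the transpose of
`Ad(g)`. -/
def IsEquivariantMomentum (f : h.MomentumMap) : Prop :=
  ∀ (g : G) (α : CotangentBundle EP P),
    f (cotangentLift (h.rightTranslation g) α) = f α ∘L adjointAction EG g

/-- `(κᵛ)^*_f : T*P → V*P` is `G`-equivariant: `(κᵛ)^*_f ∘ T*r^g = T*r^g ∘ (κᵛ)^*_f` for all
`g`. -/
def IsEquivariantVerticalMomentum (f : h.MomentumMap) : Prop :=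
  ∀ (g : G) (α : CotangentBundle EP P),
    h.verticalMomentum f (cotangentLift (h.rightTranslation g) α) =
      h.verticalCotangentLift g (h.verticalMomentum f α)

end IsPrincipalBundle

end Principal

end

noncomputable section

/-! ### Cotangent lifts and the projection of the cotangent bundle. -/

section Cotangent

variable {E N : Type*} [NormedAddCommGroup E] [NormedSpace ℝ E] [TopologicalSpace N]
  [ChartedSpace E N]

/-! Since π ∘ T*φ = φ ∘ π, the chain rule shows that pulling Θ_{f,γ} back along T*φ replaces f by f
∘ T*φ and γ by γ ∘ Tφ, for every diffeomorphism φ (`cotangentPullback_liouvilleForm`). For a gauge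
transformation, differentiating φ(u) = u.f_φ(u) gives Tφ as the sum of T r^{f_φ(u)} and ζ ∘ κˡ ∘ T
f_φ (`mfderiv_gauge`). Equivariance of γ turns the first summand into Ad(f_φ⁻¹)γ, and its values on
vertical vectors turn the second into f_φ^*κˡ.

For φ = r^g, equivariance of γ moves the whole effect of the pullback onto the momentum: f becomes α
↦ f(T*r^g α) ∘ Ad(g⁻¹). Because γ_u and Tπ are surjective, Θ_{f,γ} determines f
(`liouvilleForm_inj`), so invariance of the form is exactly equivariance of f. Passing to (κᵛ)^*_f
loses no information, since ζ_u : 𝔤 → V_uP is an isomorphism; this is where local triviality enters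
(`exists_leftInverse_fundamentalMap`). The two equivariance conditions match because T r^g sends
ζ_X(u) to the fundamental vector of Ad(g⁻¹)X at u.g. -/

theorem Diffeomorph.coe_mfderivToContinuousLinearEquiv_symm
    (φ : N ≃ₘ⟮𝓘(ℝ, E), 𝓘(ℝ, E)⟯ N) (u : N) :
    ((φ.mfderivToContinuousLinearEquiv (by simp) u).symm :
      TangentSpace 𝓘(ℝ, E) (φ u) →L[ℝ] TangentSpace 𝓘(ℝ, E) u) =
      mfderiv 𝓘(ℝ, E) 𝓘(ℝ, E) φ.symm (φ u) := by
  have h1 := ((φ.symm.contMDiff.mdifferentiable (by simp) (φ u)).hasMFDerivAt).comp u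
    (φ.contMDiff.mdifferentiable (by simp) u).hasMFDerivAt
  have h2 : φ.symm ∘ φ = id := funext φ.symm_apply_apply
  rw [h2] at h1
  have h3 := hasMFDerivAt_unique h1 (hasMFDerivAt_id u)
  ext w
  obtain ⟨v, rfl⟩ := (φ.mfderivToContinuousLinearEquiv (by simp) u).surjective w
  exact ((φ.mfderivToContinuousLinearEquiv (by simp) u).symm_apply_apply v).trans
    (DFunLike.congr_fun h3 v).symm

variable [IsManifold 𝓘(ℝ, E) ∞ N]

/-- The pullback of a smooth family of covectors along a smooth map is smooth. -/
theorem ContMDiff.covector_comp_mfderiv {EX HX X : Type*} [NormedAddCommGroup EX]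
    [NormedSpace ℝ EX] [TopologicalSpace HX] {I : ModelWithCorners ℝ EX HX} [TopologicalSpace X]
    [ChartedSpace HX X] {b : X → N} {ψ : N → N} {α : ∀ x, CotangentSpace E (ψ (b x))}
    (hα : ContMDiff I (cotangentModel E) ∞ (fun x => (⟨ψ (b x), α x⟩ : CotangentBundle E N)))
    (hb : ContMDiff I 𝓘(ℝ, E) ∞ b) (hψ : ContMDiff 𝓘(ℝ, E) 𝓘(ℝ, E) ∞ ψ) :
    ContMDiff I (cotangentModel E) ∞
      (fun x => (⟨b x, α x ∘L mfderiv 𝓘(ℝ, E) 𝓘(ℝ, E) ψ (b x)⟩ : CotangentBundle E N)) := by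
  intro x₀
  rw [contMDiffAt_hom_bundle]
  refine ⟨hb x₀, ?_⟩
  have h1 := ((contMDiffAt_hom_bundle _).1 (hα x₀)).2
  have h2 := ((hψ (b x₀)).mfderiv_const (m := ∞) (by simp)).comp x₀ (hb x₀)
  refine (h1.clm_comp h2).congr_of_eventuallyEq ?_
  -- The coordinate expressions of α and of Tψ meet in the trivialization at ψ(b x₀), and its two
  -- directions cancel wherever ψ(b x) lies in the base set.
  have h3 : ∀ᶠ x in nhds x₀, ψ (b x) ∈
      (trivializationAt E (TangentSpace 𝓘(ℝ, E)) (ψ (b x₀))).baseSet :=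
    (hψ.continuous.comp hb.continuous).continuousAt.eventually
      ((trivializationAt E (TangentSpace 𝓘(ℝ, E)) (ψ (b x₀))).open_baseSet.mem_nhds
        (mem_baseSet_trivializationAt _ _ _))
  filter_upwards [h3] with x hx
  ext v
  simp only [inTangentCoordinates, ContinuousLinearMap.inCoordinates, Function.comp_apply,
    ContinuousLinearMap.comp_apply, id]
  erw [Trivialization.symmL_continuousLinearMapAt _ hx]

  rfl

theorem contMDiff_cotangentProj :
    ContMDiff (cotangentModel E) 𝓘(ℝ, E) ∞ (cotangentProj E N) :=
  contMDiff_proj _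

theorem contMDiff_cotangentLift (φ : N ≃ₘ⟮𝓘(ℝ, E), 𝓘(ℝ, E)⟯ N) :
    ContMDiff (cotangentModel E) (cotangentModel E) ∞ (cotangentLift φ) := by
  -- The composition lemma is used with ψ = φ⁻¹ and b = φ ∘ π, so it wants covectors based at
  -- φ⁻¹(φ(π α)). This moves them to π α, which is only propositionally the same point.
  have h1 : ∀ (v u : N) (_ : v = u) (A : E →L[ℝ] ℝ),
      (⟨v, A⟩ : CotangentBundle E N) = ⟨u, A⟩ := by
    rintro v _ rfl A; rfl
  have h2 : (fun α : CotangentBundle E N =>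
      (⟨φ.symm (φ α.proj), α.snd⟩ : CotangentBundle E N)) = id :=
    funext fun α => h1 _ _ (φ.symm_apply_apply _) α.snd
  have h3 : cotangentLift φ = fun α : CotangentBundle E N =>
      (⟨φ α.proj, α.snd ∘L mfderiv 𝓘(ℝ, E) 𝓘(ℝ, E) φ.symm (φ α.proj)⟩ : CotangentBundle E N) := by
    funext α
    rw [cotangentLift, φ.coe_mfderivToContinuousLinearEquiv_symm]
  rw [h3]
  refine ContMDiff.covector_comp_mfderiv (b := fun α : CotangentBundle E N => φ α.proj)
    (ψ := φ.symm) (α := fun α => α.snd) ?_ (φ.contMDiff.comp contMDiff_cotangentProj)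
    φ.symm.contMDiff
  exact h2 ▸ contMDiff_id

/-- The derivative of `T*φ` covers the derivative of `φ`. -/
theorem mfderiv_cotangentProj_comp_cotangentLift (φ : N ≃ₘ⟮𝓘(ℝ, E), 𝓘(ℝ, E)⟯ N)
    (α : CotangentBundle E N) :
    mfderiv (cotangentModel E) 𝓘(ℝ, E) (cotangentProj E N) (cotangentLift φ α) ∘L
        mfderiv (cotangentModel E) (cotangentModel E) (cotangentLift φ) α =
      mfderiv 𝓘(ℝ, E) 𝓘(ℝ, E) φ (cotangentProj E N α) ∘L
        mfderiv (cotangentModel E) 𝓘(ℝ, E) (cotangentProj E N) α := by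
  have hp : MDifferentiable (cotangentModel E) 𝓘(ℝ, E) (cotangentProj E N) :=
    contMDiff_cotangentProj.mdifferentiable (by simp)
  have hl := (contMDiff_cotangentLift φ).mdifferentiable (by simp)
  have hφ := φ.contMDiff.mdifferentiable (by simp)
  have h1 := ((hp (cotangentLift φ α)).hasMFDerivAt).comp α (hl α).hasMFDerivAt
  have h2 := ((hφ (cotangentProj E N α)).hasMFDerivAt).comp α (hp α).hasMFDerivAt
  exact hasMFDerivAt_unique h1 h2

/-- The local section through α that is constant in a trivialization is smooth, and its derivative
is a right inverse of Tπ. -/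
theorem mfderiv_cotangentProj_surjective (α : CotangentBundle E N) :
    Function.Surjective (mfderiv (cotangentModel E) 𝓘(ℝ, E) (cotangentProj E N) α) := by
  set e := trivializationAt (E →L[ℝ] ℝ) (fun u : N => CotangentSpace E u) α.proj
  have he : α ∈ e.source := e.mem_source.2 (mem_baseSet_trivializationAt _ _ _)
  have hs : ContMDiffAt 𝓘(ℝ, E) (cotangentModel E) ∞
      (fun u : N => e.toOpenPartialHomeomorph.symm (u, (e α).2)) α.proj := by
    have h1 : ContMDiffAt (cotangentModel E) (cotangentModel E) ∞
        e.toOpenPartialHomeomorph.symm (α.proj, (e α).2) :=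
      (e.contMDiffOn_symm (IB := 𝓘(ℝ, E)) (n := ∞)).contMDiffAt
        (e.open_target.mem_nhds (e.mem_target.2 (e.mem_source.1 he)))
    exact h1.comp α.proj (contMDiffAt_id.prodMk contMDiffAt_const)
  have hα : e.toOpenPartialHomeomorph.symm (α.proj, (e α).2) = α := e.symm_apply_mk_proj he
  have h1 := (hs.mdifferentiableAt (by simp)).hasMFDerivAt
  have h2 : HasMFDerivAt (cotangentModel E) 𝓘(ℝ, E) (cotangentProj E N)
      (e.toOpenPartialHomeomorph.symm (α.proj, (e α).2))
      (mfderiv (cotangentModel E) 𝓘(ℝ, E) (cotangentProj E N)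
        (e.toOpenPartialHomeomorph.symm (α.proj, (e α).2))) :=
    (contMDiff_cotangentProj.mdifferentiable (by simp) _).hasMFDerivAt
  have h3 := h2.comp α.proj h1
  have h4 : (cotangentProj E N ∘ fun u : N => e.toOpenPartialHomeomorph.symm (u, (e α).2))
      =ᶠ[nhds α.proj] id := by
    filter_upwards [e.open_baseSet.mem_nhds (e.mem_source.1 he)] with u hu
    exact e.proj_symm_apply (e.mem_target.2 hu)
  have h5 := hasMFDerivAt_unique (h3.congr_of_eventuallyEq h4.symm) (hasMFDerivAt_id α.proj)
  rw [hα] at h5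
  exact fun v => ⟨_, DFunLike.congr_fun h5 v⟩

end Cotangent
end

noncomputable section

/-- The chain rule, with the intermediate point known only up to a propositional equality. -/
theorem HasMFDerivAt.comp_of_apply_eq {E H N E' H' N' E'' H'' N'' : Type*}
    [NormedAddCommGroup E] [NormedSpace ℝ E] [TopologicalSpace H] {I : ModelWithCorners ℝ E H}
    [TopologicalSpace N] [ChartedSpace H N]
    [NormedAddCommGroup E'] [NormedSpace ℝ E'] [TopologicalSpace H'] {I' : ModelWithCorners ℝ E' H'}
    [TopologicalSpace N'] [ChartedSpace H' N']
    [NormedAddCommGroup E''] [NormedSpace ℝ E''] [TopologicalSpace H'']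
    {I'' : ModelWithCorners ℝ E'' H''} [TopologicalSpace N''] [ChartedSpace H'' N'']
    {f : N → N'} {g : N' → N''} {x : N} {y : N'} {f' : E →L[ℝ] E'} {g' : E' →L[ℝ] E''}
    (hg : HasMFDerivAt I' I'' g y g') (hf : HasMFDerivAt I I' f x f') (hy : f x = y) :
    HasMFDerivAt I I'' (g ∘ f) x (g' ∘L f') := by
  subst hy
  exact HasMFDerivAt.comp x hg hf

/-! ### The adjoint action and the Maurer-Cartan form. -/

section Group

variable {E G : Type*} [NormedAddCommGroup E] [NormedSpace ℝ E]
  [TopologicalSpace G] [ChartedSpace E G] [Group G] [LieGroup 𝓘(ℝ, E) ∞ G]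

theorem hasMFDerivAt_conj (g : G) :
    HasMFDerivAt 𝓘(ℝ, E) 𝓘(ℝ, E) (fun h : G => g * h * g⁻¹) 1 (adjointAction E g) :=
  (((contMDiff_const.mul contMDiff_id).mul contMDiff_const :
    ContMDiff 𝓘(ℝ, E) 𝓘(ℝ, E) ∞ (fun h : G => g * h * g⁻¹)).mdifferentiable
      (by simp) 1).hasMFDerivAt

theorem hasMFDerivAt_leftMaurerCartan (g : G) :
    HasMFDerivAt 𝓘(ℝ, E) 𝓘(ℝ, E) (fun h : G => g⁻¹ * h) g (leftMaurerCartan E g) :=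
  ((contMDiff_const.mul contMDiff_id :
    ContMDiff 𝓘(ℝ, E) 𝓘(ℝ, E) ∞ (fun h : G => g⁻¹ * h)).mdifferentiable (by simp) g).hasMFDerivAt

theorem adjointAction_comp_adjointAction_inv (g : G) :
    adjointAction E g ∘L adjointAction E g⁻¹ =
      ContinuousLinearMap.id ℝ (GroupLieAlgebra 𝓘(ℝ, E) G) := by
  have h1 := (hasMFDerivAt_conj (E := E) g).comp_of_apply_eq (hasMFDerivAt_conj (E := E) g⁻¹)
    (by group)
  have h2 : (fun h : G => g * h * g⁻¹) ∘ (fun h : G => g⁻¹ * h * g⁻¹⁻¹) = id := by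
    funext h; simp only [Function.comp_apply, id]; group
  rw [h2] at h1
  exact hasMFDerivAt_unique h1 (hasMFDerivAt_id (1 : G))

theorem adjointAction_inv_comp_adjointAction (g : G) :
    adjointAction E g⁻¹ ∘L adjointAction E g =
      ContinuousLinearMap.id ℝ (GroupLieAlgebra 𝓘(ℝ, E) G) := by
  simpa using adjointAction_comp_adjointAction_inv (E := E) g⁻¹

end Group

/-! ### Fundamental vectors and the vertical bundle. -/

namespace IsPrincipalBundle

variable {EP EM EG P M G : Type*}
  [NormedAddCommGroup EP] [NormedSpace ℝ EP] [TopologicalSpace P] [ChartedSpace EP P]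
  [NormedAddCommGroup EM] [NormedSpace ℝ EM] [TopologicalSpace M] [ChartedSpace EM M]
  [NormedAddCommGroup EG] [NormedSpace ℝ EG] [TopologicalSpace G] [ChartedSpace EG G]
  [Group G] [MulAction Gᵐᵒᵖ P]
  {p : P → M} (h : IsPrincipalBundle EP EM EG G p)

theorem eq_of_smul_eq_smul (h : IsPrincipalBundle EP EM EG G p) {u : P} {g k : G}
    (hgk : u <• g = u <• k) : g = k := by
  refine mul_inv_eq_one.1 (h.free u _ ?_)
  rw [← op_smul_op_smul, hgk, op_smul_op_smul, mul_inv_cancel, MulOpposite.op_one, one_smul]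

theorem hasMFDerivAt_orbit (u : P) :
    HasMFDerivAt 𝓘(ℝ, EG) 𝓘(ℝ, EP) (fun g : G => u <• g) 1 (h.fundamentalMap u) :=
  ((h.contMDiff_orbit u).mdifferentiable (by simp) 1).hasMFDerivAt

theorem hasMFDerivAt_rightTranslation (g : G) (u : P) :
    HasMFDerivAt 𝓘(ℝ, EP) 𝓘(ℝ, EP) (h.rightTranslation g) u
      (mfderiv 𝓘(ℝ, EP) 𝓘(ℝ, EP) (h.rightTranslation g) u) :=
  ((h.rightTranslation g).contMDiff.mdifferentiable (by simp) u).hasMFDerivAt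

theorem GaugeTransformation.hasMFDerivAt {h : IsPrincipalBundle EP EM EG G p}
    (φ : h.GaugeTransformation) (u : P) :
    HasMFDerivAt 𝓘(ℝ, EP) 𝓘(ℝ, EP) φ.toDiffeomorph u
      (mfderiv 𝓘(ℝ, EP) 𝓘(ℝ, EP) φ.toDiffeomorph u) :=
  (φ.toDiffeomorph.contMDiff.mdifferentiable (by simp) u).hasMFDerivAt

/-- φ carries the orbit map of u to the orbit map of φ(u), so fundamental vector fields are
preserved. -/
theorem mfderiv_gauge_comp_fundamentalMap (φ : h.GaugeTransformation) (u : P) :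
    (mfderiv 𝓘(ℝ, EP) 𝓘(ℝ, EP) φ.toDiffeomorph u ∘L h.fundamentalMap u : EG →L[ℝ] EP) =
      h.fundamentalMap (φ.toDiffeomorph u) := by
  have h1 := (φ.hasMFDerivAt u).comp_of_apply_eq (h.hasMFDerivAt_orbit u) (by simp)
  have h2 : φ.toDiffeomorph ∘ (fun g : G => u <• g) = fun g : G => φ.toDiffeomorph u <• g :=
    funext fun g => φ.map_smul u g
  rw [h2] at h1
  exact hasMFDerivAt_unique h1 (h.hasMFDerivAt_orbit _)

/-- An equality of one-forms at two equal points. -/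
theorem LieAlgebraForm.congr_point {h : IsPrincipalBundle EP EM EG G p} (γ : h.LieAlgebraForm)
    {u v : P} (huv : u = v) : (γ u : EP →L[ℝ] EG) = γ v := by
  subst huv; rfl

variable [LieGroup 𝓘(ℝ, EG) ∞ G]

/-- Differentiate u.k.g = (u.g).(g⁻¹kg) at k = 1. -/
theorem mfderiv_rightTranslation_comp_fundamentalMap (g : G) (u : P) :
    mfderiv 𝓘(ℝ, EP) 𝓘(ℝ, EP) (h.rightTranslation g) u ∘L h.fundamentalMap u =
      h.fundamentalMap (h.rightTranslation g u) ∘L adjointAction EG g⁻¹ := by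
  have h1 := (h.hasMFDerivAt_rightTranslation g u).comp_of_apply_eq (h.hasMFDerivAt_orbit u)
    (by simp)
  have h2 := (h.hasMFDerivAt_orbit (u <• g)).comp_of_apply_eq (hasMFDerivAt_conj (E := EG) g⁻¹)
    (by group)
  have h3 : h.rightTranslation g ∘ (fun k : G => u <• k) =
      (fun k : G => (u <• g) <• k) ∘ fun k : G => g⁻¹ * k * g⁻¹⁻¹ := by
    funext k
    change (u <• k) <• g = (u <• g) <• (g⁻¹ * k * g⁻¹⁻¹)
    rw [op_smul_op_smul, op_smul_op_smul]
    congr 2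
    group
  rw [h3] at h1
  exact hasMFDerivAt_unique h1 h2

/-- Writing u.k = (u.g).(g⁻¹k) moves the derivative at g to a derivative at 1. -/
theorem mfderiv_orbit (u : P) (g : G) :
    (mfderiv 𝓘(ℝ, EG) 𝓘(ℝ, EP) (fun k : G => u <• k) g : EG →L[ℝ] EP) =
      h.fundamentalMap (u <• g) ∘L leftMaurerCartan EG g := by
  have h1 := (h.hasMFDerivAt_orbit (u <• g)).comp_of_apply_eq
    (hasMFDerivAt_leftMaurerCartan (E := EG) g) (by simp)
  have h2 : (fun k : G => (u <• g) <• k) ∘ (fun k : G => g⁻¹ * k) = fun k : G => u <• k := by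
    funext k
    simp only [Function.comp_apply]
    rw [op_smul_op_smul, mul_inv_cancel_left]
  rw [h2] at h1
  exact h1.mfderiv

/-- A local trivialization provides a left inverse of `ζ_u` which inverts it on `V_u P`. -/
theorem exists_leftInverse_fundamentalMap (u : P) :
    ∃ K : TangentSpace 𝓘(ℝ, EP) u →L[ℝ] GroupLieAlgebra 𝓘(ℝ, EG) G,
      (∀ X, K (h.fundamentalMap u X) = X) ∧
        ∀ v ∈ h.verticalSpace u, h.fundamentalMap u (K v) = v := by
  obtain ⟨e, he, hs, hs', heq⟩ := h.locally_trivial (p u)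
  have hu : u ∈ e.source := e.mem_source.2 he
  set a : G := (e u).2 with ha
  have hpa : e u = (p u, a) := Prod.ext (e.coe_fst hu) rfl
  have hq : HasMFDerivAt 𝓘(ℝ, EP) 𝓘(ℝ, EG) (fun w => (e w).2) u
      (mfderiv 𝓘(ℝ, EP) 𝓘(ℝ, EG) (fun w => (e w).2) u) :=
    ((contMDiffAt_snd.comp u (hs.contMDiffAt (e.open_source.mem_nhds hu))).mdifferentiableAt
      (by simp)).hasMFDerivAt
  have hL := hasMFDerivAt_leftMaurerCartan (E := EG) a
  have hT : (p u, a) ∈ e.target := hpa ▸ e.map_source hu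
  have hD := ((hs'.contMDiffAt (e.open_target.mem_nhds hT)).mdifferentiableAt
    (by simp)).hasMFDerivAt
  have hp := (h.contMDiff_proj.mdifferentiable (by simp) u).hasMFDerivAt
  have hsource : ∀ k : G, u <• k ∈ e.source := fun k => e.mem_source.2 (by rwa [h.proj_smul])
  -- In the fibre coordinate the orbit map is k ↦ ak, which left translation by a⁻¹ undoes. Hence K
  -- is κˡ_a composed with the derivative of the fibre coordinate.
  have h1 := hL.comp_of_apply_eq (hq.comp_of_apply_eq (h.hasMFDerivAt_orbit u) (by simp))
    (by simp [ha])
  have h2 : (fun k => a⁻¹ * k) ∘ (fun w => (e w).2) ∘ (fun g : G => u <• g) = id := by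
    funext k
    simp only [Function.comp_apply, id]
    rw [heq u hu k, inv_mul_cancel_left]
  rw [h2] at h1
  have h3 := hasMFDerivAt_unique h1 (hasMFDerivAt_id (1 : G))
  have h4 := hD.comp_of_apply_eq (hp.prodMk hq) rfl
  have h5 : e.toOpenPartialHomeomorph.symm ∘ (fun w => (p w, (e w).2)) =ᶠ[nhds u] id := by
    filter_upwards [e.open_source.mem_nhds hu] with w hw
    have : (p w, (e w).2) = e w := Prod.ext (e.coe_fst hw).symm rfl
    simp only [Function.comp_apply, id, this]
    exact e.left_inv hw
  have h4' := h4.congr_of_eventuallyEq h5.symm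
  have h6 := hasMFDerivAt_unique h4' (hasMFDerivAt_id u)
  -- The fibre parametrization k ↦ e⁻¹(p u, k) equals k ↦ u.(a⁻¹k). Differentiating at a, its
  -- derivative is ζ_u ∘ κˡ_a.
  have h7 := hD.comp_of_apply_eq ((hasMFDerivAt_const (p u) a).prodMk (hasMFDerivAt_id a)) rfl
  have h8 := (h.hasMFDerivAt_orbit u).comp_of_apply_eq hL (by simp)
  have h9 : e.toOpenPartialHomeomorph.symm ∘ (fun k : G => (p u, id k)) =
      (fun g : G => u <• g) ∘ fun k => a⁻¹ * k := by
    funext k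
    simp only [Function.comp_apply, id]
    have : (p u, k) = e (u <• (a⁻¹ * k)) := by
      refine Prod.ext ?_ ?_
      · rw [e.coe_fst (hsource _), h.proj_smul]
      · rw [heq u hu, ← ha, mul_inv_cancel_left]
    rw [this]
    exact e.left_inv (hsource _)
  rw [h9] at h7
  have h10 := hasMFDerivAt_unique h7 h8
  refine ⟨leftMaurerCartan EG a ∘L mfderiv 𝓘(ℝ, EP) 𝓘(ℝ, EG) (fun w => (e w).2) u,
    fun X => DFunLike.congr_fun h3 X, fun v hv => ?_⟩
  have hv' : mfderiv 𝓘(ℝ, EP) 𝓘(ℝ, EM) p u v = 0 := hv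
  have h11 := DFunLike.congr_fun h10 (mfderiv 𝓘(ℝ, EP) 𝓘(ℝ, EG) (fun w => (e w).2) u v)
  have h12 := DFunLike.congr_fun h6 v
  -- For vertical v the base component Tp(v) vanishes, so reconstructing v through e⁻¹ uses only the
  -- fibre direction.
  refine h11.symm.trans (Eq.trans ?_ h12)
  exact congrArg (fun z : EM => mfderiv (𝓘(ℝ, EM).prod 𝓘(ℝ, EG)) 𝓘(ℝ, EP)
    e.toOpenPartialHomeomorph.symm (p u, a)
      ((z, mfderiv 𝓘(ℝ, EP) 𝓘(ℝ, EG) (fun w => (e w).2) u v) : EM × EG)) hv'.symm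

/-- `ContinuousLinearMap.inverse` is zero on non-invertible maps, so this is what makes
`verticalParallelism` a genuine inverse of ζ_u. -/
theorem isInvertible_verticalFundamentalMap (u : P) :
    (h.verticalFundamentalMap u).IsInvertible := by
  obtain ⟨K, hK, hK'⟩ := h.exists_leftInverse_fundamentalMap u
  refine ⟨ContinuousLinearEquiv.equivOfInverse (h.verticalFundamentalMap u)
    (K ∘L (h.verticalSpace u).subtypeL) hK (fun v => Subtype.ext (hK' v.1 v.2)), ?_⟩
  ext X
  rfl

theorem verticalParallelism_verticalFundamentalMap (u : P) (X : GroupLieAlgebra 𝓘(ℝ, EG) G) :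
    h.verticalParallelism u (h.verticalFundamentalMap u X) = X :=
  (h.isInvertible_verticalFundamentalMap u).inverse_apply_eq.2 rfl

theorem verticalFundamentalMap_verticalParallelism (u : P) (v : h.verticalSpace u) :
    h.verticalFundamentalMap u (h.verticalParallelism u v) = v :=
  ((h.isInvertible_verticalFundamentalMap u).inverse_apply_eq.1 rfl).symm

/-- Fundamental vectors exhaust V_uP, so verticality can be tested without mentioning κᵛ. -/
theorem comp_subtypeL_eq_verticalParallelism_iff (γ : h.LieAlgebraForm) (u : P) :
    γ u ∘L (h.verticalSpace u).subtypeL = h.verticalParallelism u ↔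
      ∀ X, γ u (h.fundamentalMap u X) = X := by
  refine ⟨fun hγ X => ?_, fun hγ => ?_⟩
  · exact (DFunLike.congr_fun hγ (h.verticalFundamentalMap u X)).trans
      (h.verticalParallelism_verticalFundamentalMap u X)
  · ext v
    obtain ⟨X, rfl⟩ : ∃ X, h.verticalFundamentalMap u X = v :=
      ⟨_, h.verticalFundamentalMap_verticalParallelism u v⟩
    exact (hγ X).trans (h.verticalParallelism_verticalFundamentalMap u X).symm

end IsPrincipalBundle
end

noncomputable section

theorem comp_adjointAction_inv_eq_iff {E G : Type*} [NormedAddCommGroup E] [NormedSpace ℝ E]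
    [TopologicalSpace G] [ChartedSpace E G] [Group G] [LieGroup 𝓘(ℝ, E) ∞ G]
    (ξ η : GroupLieAlgebra 𝓘(ℝ, E) G →L[ℝ] ℝ) (g : G) :
    ξ ∘L adjointAction E g⁻¹ = η ↔ ξ = η ∘L adjointAction E g := by
  constructor
  · rintro rfl
    rw [ContinuousLinearMap.comp_assoc, adjointAction_inv_comp_adjointAction]
    rfl
  · rintro rfl
    rw [ContinuousLinearMap.comp_assoc, adjointAction_comp_adjointAction_inv]
    rfl

/-! ### Gauge functions, pullbacks of Liouville forms and equivariance. -/

namespace IsPrincipalBundle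

variable {EP EM EG P M G : Type*}
  [NormedAddCommGroup EP] [NormedSpace ℝ EP] [TopologicalSpace P] [ChartedSpace EP P]
  [NormedAddCommGroup EM] [NormedSpace ℝ EM] [TopologicalSpace M] [ChartedSpace EM M]
  [NormedAddCommGroup EG] [NormedSpace ℝ EG] [TopologicalSpace G] [ChartedSpace EG G]
  [Group G] [MulAction Gᵐᵒᵖ P]
  {p : P → M} (h : IsPrincipalBundle EP EM EG G p)

/-- Both sides move u.g to φ(u.g) = φ(u).g, and the action is free. -/
theorem gaugeFunction_smul (φ : h.GaugeTransformation) (u : P) (g : G) :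
    h.gaugeFunction φ (u <• g) = g⁻¹ * h.gaugeFunction φ u * g := by
  refine h.eq_of_smul_eq_smul (u := u <• g) ?_
  rw [← h.gaugeFunction_spec, φ.map_smul, h.gaugeFunction_spec φ u, op_smul_op_smul,
    op_smul_op_smul, mul_assoc, mul_inv_cancel_left]

/-- The pullback of a Liouville form along `T*φ`. -/
theorem cotangentPullback_liouvilleForm [IsManifold 𝓘(ℝ, EP) ∞ P]
    (φ : P ≃ₘ⟮𝓘(ℝ, EP), 𝓘(ℝ, EP)⟯ P) (f : h.MomentumMap) (γ : h.LieAlgebraForm) :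
    cotangentPullback φ (h.liouvilleForm f γ) =
      h.liouvilleForm (f ∘ cotangentLift φ)
        (fun u => γ (φ u) ∘L mfderiv 𝓘(ℝ, EP) 𝓘(ℝ, EP) φ u) := by
  funext α
  ext Ξ
  exact congrArg (fun v => f (cotangentLift φ α) (γ (φ (cotangentProj EP P α)) v))
    (DFunLike.congr_fun (mfderiv_cotangentProj_comp_cotangentLift φ α) Ξ)

theorem IsSmoothMomentum.comp_cotangentLift [IsManifold 𝓘(ℝ, EP) ∞ P]
    {h : IsPrincipalBundle EP EM EG G p} {f : h.MomentumMap} (hf : h.IsSmoothMomentum f)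
    (φ : P ≃ₘ⟮𝓘(ℝ, EP), 𝓘(ℝ, EP)⟯ P) : h.IsSmoothMomentum (f ∘ cotangentLift φ) :=
  fun X => (hf X).comp (contMDiff_cotangentLift φ)

theorem IsPrincipalConnection.cotangentPullback_rightTranslation_liouvilleForm
    [IsManifold 𝓘(ℝ, EP) ∞ P] {h : IsPrincipalBundle EP EM EG G p} {γ : h.LieAlgebraForm}
    (hγ : h.IsPrincipalConnection γ) (f : h.MomentumMap) (g : G) :
    cotangentPullback (h.rightTranslation g) (h.liouvilleForm f γ) =
      h.liouvilleForm (fun α => f (cotangentLift (h.rightTranslation g) α) ∘L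
        adjointAction EG g⁻¹) γ := by
  rw [cotangentPullback_liouvilleForm]
  have : (fun u => γ (h.rightTranslation g u) ∘L
      mfderiv 𝓘(ℝ, EP) 𝓘(ℝ, EP) (h.rightTranslation g) u) =
        fun u => adjointAction EG g⁻¹ ∘L γ u := funext fun u => hγ.equivariant g u
  exact congrArg (h.liouvilleForm (f ∘ cotangentLift (h.rightTranslation g))) this

variable [LieGroup 𝓘(ℝ, EG) ∞ G]

/-- Although `gaugeFunction` is defined by choice, in a fibre coordinate q it is forced to be q⁻¹ ·
(q ∘ φ), which is smooth. -/
theorem contMDiff_gaugeFunction (φ : h.GaugeTransformation) :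
    ContMDiff 𝓘(ℝ, EP) 𝓘(ℝ, EG) ∞ (h.gaugeFunction φ) := by
  intro u
  obtain ⟨e, he, hs, -, heq⟩ := h.locally_trivial (p u)
  have hu : u ∈ e.source := e.mem_source.2 he
  have hφu : φ.toDiffeomorph u ∈ e.source := e.mem_source.2 (by rwa [φ.proj_apply])
  have h1 : ContMDiffAt 𝓘(ℝ, EP) 𝓘(ℝ, EG) ∞ (fun w => (e w).2) u :=
    contMDiffAt_snd.comp u (hs.contMDiffAt (e.open_source.mem_nhds hu))
  have h2 : ContMDiffAt 𝓘(ℝ, EP) 𝓘(ℝ, EG) ∞ (fun w => (e (φ.toDiffeomorph w)).2) u :=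
    contMDiffAt_snd.comp u ((hs.contMDiffAt (e.open_source.mem_nhds hφu)).comp u
      φ.toDiffeomorph.contMDiff.contMDiffAt)
  refine (h1.inv.mul h2).congr_of_eventuallyEq ?_
  filter_upwards [e.open_source.mem_nhds hu] with w hw
  rw [Pi.mul_apply, h.gaugeFunction_spec φ w, heq w hw, inv_mul_cancel_left]

theorem verticalInverse_verticalFundamentalMap (g : G) (u : P)
    (X : GroupLieAlgebra 𝓘(ℝ, EG) G) :
    h.verticalInverse (h.rightTranslation g) (fun u => h.proj_smul u g) u
        (h.verticalFundamentalMap (h.rightTranslation g u) X) =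
      h.verticalFundamentalMap u (adjointAction EG g X) := by
  refine Subtype.ext ?_
  have h1 := DFunLike.congr_fun (h.mfderiv_rightTranslation_comp_fundamentalMap g u)
    (adjointAction EG g X)
  have h2 := congrArg (h.fundamentalMap (h.rightTranslation g u))
    (DFunLike.congr_fun (adjointAction_inv_comp_adjointAction (E := EG) g) X)
  exact (ContinuousLinearEquiv.symm_apply_eq _).2 (h1.trans h2).symm

/-- Evaluated on the fundamental vector of X at u.g, equivariance of (κᵛ)^*_f reads f(T*r^g α)(X) =
f(α)(Ad(g)X), and such vectors fill V_{u.g}P. -/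
theorem isEquivariantMomentum_iff (f : h.MomentumMap) :
    h.IsEquivariantMomentum f ↔ h.IsEquivariantVerticalMomentum f := by
  refine forall_congr' fun g => forall_congr' fun α => ?_
  set u := cotangentProj EP P α
  have h1 : h.verticalMomentum f (cotangentLift (h.rightTranslation g) α) =
      ⟨h.rightTranslation g u, f (cotangentLift (h.rightTranslation g) α) ∘L
        h.verticalParallelism (h.rightTranslation g u)⟩ := rfl
  have h2 : h.verticalCotangentLift g (h.verticalMomentum f α) =
      ⟨h.rightTranslation g u, (f α ∘L h.verticalParallelism u) ∘L
        h.verticalInverse (h.rightTranslation g) (fun u => h.proj_smul u g) u⟩ := rfl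
  have h3 : ∀ X, h.verticalParallelism u
      (h.verticalInverse (h.rightTranslation g) (fun u => h.proj_smul u g) u
        (h.verticalFundamentalMap (h.rightTranslation g u) X)) = adjointAction EG g X := fun X => by
    rw [verticalInverse_verticalFundamentalMap, verticalParallelism_verticalFundamentalMap]
  -- Both sides lie definitionally over u.g, so only the linear forms need comparison.
  rw [h1, h2, Sigma.mk.injEq, heq_eq_eq]
  refine ⟨fun hf => ⟨rfl, ?_⟩, fun hf => ?_⟩
  · ext v
    obtain ⟨X, rfl⟩ : ∃ X, h.verticalFundamentalMap (h.rightTranslation g u) X = v :=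
      ⟨_, h.verticalFundamentalMap_verticalParallelism _ v⟩
    simp only [ContinuousLinearMap.comp_apply]
    rw [h3, verticalParallelism_verticalFundamentalMap, hf]
    rfl
  · ext X
    have h4 := DFunLike.congr_fun hf.2 (h.verticalFundamentalMap (h.rightTranslation g u) X)
    simp only [ContinuousLinearMap.comp_apply] at h4
    rwa [h3, verticalParallelism_verticalFundamentalMap] at h4

/-- Leibniz rule for the action applied to u ↦ (u, f_φ(u)); the derivative in the group variable is
rewritten by `mfderiv_orbit`. -/
theorem mfderiv_gauge {h : IsPrincipalBundle EP EM EG G p} (φ : h.GaugeTransformation)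
    (u : P) :
    (mfderiv 𝓘(ℝ, EP) 𝓘(ℝ, EP) φ.toDiffeomorph u : EP →L[ℝ] EP) =
      mfderiv 𝓘(ℝ, EP) 𝓘(ℝ, EP) (h.rightTranslation (h.gaugeFunction φ u)) u +
        h.fundamentalMap (h.rightTranslation (h.gaugeFunction φ u) u) ∘L
          leftMaurerCartan EG (h.gaugeFunction φ u) ∘L
            mfderiv 𝓘(ℝ, EP) 𝓘(ℝ, EG) (h.gaugeFunction φ) u := by
  have hA := h.contMDiff_action.mdifferentiable (by simp) (u, h.gaugeFunction φ u)
  have hf := ((h.contMDiff_gaugeFunction φ).mdifferentiable (by simp) u).hasMFDerivAt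
  have h1 := hA.hasMFDerivAt.comp_of_apply_eq ((hasMFDerivAt_id u).prodMk hf) rfl
  have h2 : (fun x : P × G => x.1 <• x.2) ∘ (fun u => (id u, h.gaugeFunction φ u)) =
      φ.toDiffeomorph := funext fun u => (h.gaugeFunction_spec φ u).symm
  rw [h2] at h1
  refine h1.mfderiv.trans ?_
  rw [mfderiv_prod_eq_add_comp hA]
  ext v
  exact congrArg₂ (fun x y : EP => x + y) rfl (DFunLike.congr_fun
    (h.mfderiv_orbit u (h.gaugeFunction φ u))
    (mfderiv 𝓘(ℝ, EP) 𝓘(ℝ, EG) (h.gaugeFunction φ) u v))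

/-! ### Principal connections and their Liouville forms. -/

variable [IsManifold 𝓘(ℝ, EP) ∞ P] {h} {γ : h.LieAlgebraForm}

theorem IsPrincipalConnection.apply_fundamentalMap (hγ : h.IsPrincipalConnection γ) (u : P)
    (X : GroupLieAlgebra 𝓘(ℝ, EG) G) : γ u (h.fundamentalMap u X) = X :=
  (h.comp_subtypeL_eq_verticalParallelism_iff γ u).1 (hγ.vertical u) X

theorem IsPrincipalConnection.gaugePullback (hγ : h.IsPrincipalConnection γ)
    (φ : h.GaugeTransformation) : h.IsPrincipalConnection (h.gaugePullback φ γ) where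
  smooth ξ := ContMDiff.covector_comp_mfderiv (b := id) (ψ := φ.toDiffeomorph)
    (α := fun u => ξ ∘L γ (φ.toDiffeomorph u))
    ((hγ.smooth ξ).comp φ.toDiffeomorph.contMDiff) contMDiff_id φ.toDiffeomorph.contMDiff
  equivariant g u := by
    have h1 := (φ.hasMFDerivAt (h.rightTranslation g u)).comp_of_apply_eq
      (h.hasMFDerivAt_rightTranslation g u) rfl
    have h2 := (h.hasMFDerivAt_rightTranslation g (φ.toDiffeomorph u)).comp_of_apply_eq
      (φ.hasMFDerivAt u) rfl
    have h3 : φ.toDiffeomorph ∘ h.rightTranslation g = h.rightTranslation g ∘ φ.toDiffeomorph :=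
      funext fun u => φ.map_smul u g
    rw [h3] at h1
    have h4 := hasMFDerivAt_unique h1 h2
    have h5 : φ.toDiffeomorph (h.rightTranslation g u) =
      h.rightTranslation g (φ.toDiffeomorph u) := φ.map_smul u g
    ext v
    -- φ(u.g) and φ(u).g agree only propositionally, so γ is moved between these points before φ ∘
    -- r^g = r^g ∘ φ is used on derivatives.
    have h7 := γ.congr_point h5
    have h6 := DFunLike.congr_fun h7
      (mfderiv 𝓘(ℝ, EP) 𝓘(ℝ, EP) φ.toDiffeomorph (h.rightTranslation g u)
        (mfderiv 𝓘(ℝ, EP) 𝓘(ℝ, EP) (h.rightTranslation g) u v))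
    refine h6.trans ((congrArg (γ (h.rightTranslation g (φ.toDiffeomorph u)))
      (DFunLike.congr_fun h4 v)).trans ?_)
    exact DFunLike.congr_fun (hγ.equivariant g (φ.toDiffeomorph u))
      (mfderiv 𝓘(ℝ, EP) 𝓘(ℝ, EP) φ.toDiffeomorph u v)
  vertical u := by
    refine (h.comp_subtypeL_eq_verticalParallelism_iff _ u).2 fun X => ?_
    exact (congrArg (γ (φ.toDiffeomorph u))
      (DFunLike.congr_fun (h.mfderiv_gauge_comp_fundamentalMap φ u) X)).trans
        (hγ.apply_fundamentalMap _ X)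

theorem IsPrincipalConnection.gaugePullback_eq_gaugeTransform (hγ : h.IsPrincipalConnection γ)
    (φ : h.GaugeTransformation) : h.gaugePullback φ γ = h.gaugeTransform φ γ := by
  funext u
  ext v
  set w : GroupLieAlgebra 𝓘(ℝ, EG) G := leftMaurerCartan EG (h.gaugeFunction φ u)
    (mfderiv 𝓘(ℝ, EP) 𝓘(ℝ, EG) (h.gaugeFunction φ) u v) with hw
  have h2 := γ.congr_point (h.gaugeFunction_spec φ u)
  have h1 := DFunLike.congr_fun h2
    (mfderiv 𝓘(ℝ, EP) 𝓘(ℝ, EP) φ.toDiffeomorph u v)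
  refine h1.trans ((congrArg (γ (u <• h.gaugeFunction φ u))
    (DFunLike.congr_fun (mfderiv_gauge φ u) v)).trans ?_)
  refine ((γ (u <• h.gaugeFunction φ u)).map_add _ _).trans ?_
  exact congrArg₂ (fun x y : EG => x + y)
    (DFunLike.congr_fun (hγ.equivariant (h.gaugeFunction φ u) u) v)
    (hγ.apply_fundamentalMap (u <• h.gaugeFunction φ u) w)

theorem IsPrincipalConnection.surjective (hγ : h.IsPrincipalConnection γ) (u : P) :
    Function.Surjective (γ u) :=
  fun X => ⟨_, hγ.apply_fundamentalMap u X⟩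

/-- Every X ∈ 𝔤 is γ(Tπ Ξ) for some Ξ tangent to T*P at α, so the values of the form at α recover
f(α). -/
theorem IsPrincipalConnection.liouvilleForm_inj (hγ : h.IsPrincipalConnection γ)
    {f f' : h.MomentumMap} : h.liouvilleForm f γ = h.liouvilleForm f' γ ↔ f = f' := by
  refine ⟨fun hff => ?_, fun hff => by rw [hff]⟩
  funext α
  ext X
  obtain ⟨v, rfl⟩ := hγ.surjective (cotangentProj EP P α) X
  obtain ⟨Ξ, rfl⟩ := mfderiv_cotangentProj_surjective α v
  exact DFunLike.congr_fun (congrFun hff α) Ξ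

theorem IsPrincipalConnection.isInvariantForm_liouvilleForm_iff (hγ : h.IsPrincipalConnection γ)
    (f : h.MomentumMap) :
    h.IsInvariantForm (h.liouvilleForm f γ) ↔ h.IsEquivariantMomentum f := by
  refine forall_congr' fun g => ?_
  rw [hγ.cotangentPullback_rightTranslation_liouvilleForm, hγ.liouvilleForm_inj, funext_iff]
  exact forall_congr' fun α => comp_adjointAction_inv_eq_iff _ _ g

end IsPrincipalBundle
end

theorem mainTheorem10
    {EP EM EG P M G : Type*}
    [NormedAddCommGroup EP] [NormedSpace ℝ EP] [FiniteDimensional ℝ EP]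
    [NormedAddCommGroup EM] [NormedSpace ℝ EM] [FiniteDimensional ℝ EM]
    [NormedAddCommGroup EG] [NormedSpace ℝ EG] [FiniteDimensional ℝ EG]
    [TopologicalSpace P] [ChartedSpace EP P] [IsManifold 𝓘(ℝ, EP) ∞ P]
    [TopologicalSpace M] [ChartedSpace EM M] [IsManifold 𝓘(ℝ, EM) ∞ M]
    [TopologicalSpace G] [ChartedSpace EG G] [Group G] [LieGroup 𝓘(ℝ, EG) ∞ G]
    [MulAction Gᵐᵒᵖ P] {p : P → M} (h : IsPrincipalBundle EP EM EG G p)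
    (γ : h.LieAlgebraForm) (hγ : h.IsPrincipalConnection γ)
    (f : h.MomentumMap) (hf : h.IsSmoothMomentum f) :
    -- the behaviour under a gauge transformation `φ`
    (∀ φ : h.GaugeTransformation,
      -- `f_φ : P → G` is smooth and equivariant for the conjugation action on `G`
      ContMDiff 𝓘(ℝ, EP) 𝓘(ℝ, EG) ∞ (h.gaugeFunction φ) ∧
      (∀ (u : P) (g : G), h.gaugeFunction φ (u <• g) = g⁻¹ * h.gaugeFunction φ u * g) ∧
      -- `φ^* γ` is a principal connection and `f ∘ T*φ` is smooth
      h.IsPrincipalConnection (h.gaugePullback φ γ) ∧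
      h.IsSmoothMomentum (f ∘ cotangentLift φ.toDiffeomorph) ∧
      -- `φ^* γ = Ad(f_φ⁻¹) γ + f_φ^* κˡ`
      h.gaugePullback φ γ = h.gaugeTransform φ γ ∧
      -- `(T*φ)^* Θ_{f,γ} = ⟨f ∘ T*φ, π^*(Ad(f_φ⁻¹) γ + f_φ^* κˡ)⟩ = Θ_{f ∘ T*φ, φ^* γ}`
      cotangentPullback φ.toDiffeomorph (h.liouvilleForm f γ) =
        h.liouvilleForm (f ∘ cotangentLift φ.toDiffeomorph) (h.gaugeTransform φ γ) ∧
      cotangentPullback φ.toDiffeomorph (h.liouvilleForm f γ) =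
        h.liouvilleForm (f ∘ cotangentLift φ.toDiffeomorph) (h.gaugePullback φ γ)) ∧
    -- `Θ_{f,γ} = ⟨(κᵛ)^*_f, ζ_γ ∘ Tπ⟩`
    (∀ (α : CotangentBundle EP P) (Ξ : TangentSpace (cotangentModel EP) α),
      h.liouvilleForm f γ α Ξ =
        (h.verticalMomentum f α).2 (h.verticalProjection γ (cotangentProj EP P α)
          (mfderiv (cotangentModel EP) 𝓘(ℝ, EP) (cotangentProj EP P) α Ξ))) ∧
    -- `Θ_{f,γ}` is `G`-invariant iff `f ∘ T*r^g = Ad(g)^* ∘ f` for all `g`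
    (h.IsInvariantForm (h.liouvilleForm f γ) ↔ h.IsEquivariantMomentum f) ∧
    -- equivalently, iff `(κᵛ)^*_f` is `G`-equivariant
    (h.IsEquivariantMomentum f ↔ h.IsEquivariantVerticalMomentum f) := by
  refine ⟨fun φ => ⟨h.contMDiff_gaugeFunction φ, h.gaugeFunction_smul φ, hγ.gaugePullback φ,
    hf.comp_cotangentLift φ.toDiffeomorph, hγ.gaugePullback_eq_gaugeTransform φ, ?_,
    h.cotangentPullback_liouvilleForm φ.toDiffeomorph f γ⟩, fun α Ξ => ?_,
    hγ.isInvariantForm_liouvilleForm_iff f, h.isEquivariantMomentum_iff f⟩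
  · rw [← hγ.gaugePullback_eq_gaugeTransform φ]
    exact h.cotangentPullback_liouvilleForm φ.toDiffeomorph f γ
  -- The factor κᵛ in (κᵛ)^*_f cancels the ζ in ζ_γ.
  · exact congrArg (f α) (h.verticalParallelism_verticalFundamentalMap _ _).symm
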